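/- **Setting.** Let $q,m\ge 0$ be integers and let $\mathcal A=[\alpha^{(1)}\cdots\alpha^{(m)}]$ be a $q\times m$ matrix of nonnegative integers. Put $\phi_j(d)=d^{\alpha^{(j)}}=\prod_{i=1}^q d_i^{\alpha^{(j)}_i}$ and, for $\theta\in\mathbb R^m$, $R_\theta(d)=\sum_{j=1}^m\theta_j\phi_j(d)$ for $d\in\mathbb R^q$. The Bombieri norm on $\mathbb R^m$ is given by $$\|\theta\|_B^2=\sum_{j=1}^m\frac{\alpha^{(j)}_1!\cdots\alpha^{(j)}_q!}{(\alpha^{(j)}_1+\cdots+\alpha^{(j)}_q)!}\,\theta_j^2 .$$ For a polynomial $f$ on $\mathbb R^q$ and a positive semidefinite matrix $\Sigma$, the deconvolution $f*p_{-\Sigma}$ is the unique polynomial $g$ with $\mathbf E\,g(a+x)=f(a)$ for all $a\in\mathbb R^q$, where $x\sim\mathcal N(0,\Sigma)$. For data $\mathscr D=(d^{(1)},\dots,d^{(N)})$ in $\mathbb R^q$ and $\sigma\ge 0$, let $$Q_{\mathrm{ols}}(\theta,\mathscr D)=\sum_{k=1}^N R_\theta(d^{(k)})^2,\qquad Q_{\mathrm{als},\sigma}(\theta,\mathscr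 D)=\theta^\top\Psi(\mathscr D,\sigma)\,\theta,\qquad \Psi(\mathscr D,\sigma)_{ij}=\sum_{k=1}^N\big((\phi_i\phi_j)*p_{-\sigma^2 I}\big)(d^{(k)}).$$ Consider three estimation problems, with the following sets $\mathrm{Sol}(\mathscr D)\subseteq\mathbb R^m$ of solutions: 1. OLS: the minimizers of $Q_{\mathrm{ols}}(\cdot,\mathscr D)$ subject to $\|\theta\|_B=1$; 2. ALS with known $\sigma\ge0$: the minimizers of $Q_{\mathrm{als},\sigma}(\cdot,\mathscr D)$ subject to $\|\theta\|_B=1$; 3. ALS with unknown $\sigma$: all $\theta$ with $\|\theta\|_B=1$ for which there is $\widehat\sigma\ge 0$ such that $Q_{\mathrm{als},\widehat\sigma}(\theta,\mathscr D)=0$ and $Q_{\mathrm{als},\widehat\sigma}(b,\mathscr D)\ge0$ for all $b\in\mathbb R^m\setminus\{0\}$. For a map $T:\mathbb R^q\to\mathbb R^q$ write $T(\mathscr D)=(T(d^{(1)}),\dots,T(d^{(N)}))$. A problem is called $T$-invariant for $\mathscr D$ if for every $\theta_1\in\mathrm{Sol}(\mathscr D)$ there is $\theta_2\in\mathrm{Sol}(T(\mathscr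 D))$, and for every $\theta_2\in\mathrm{Sol}(T(\mathscr D))$ there is $\theta_1\in\mathrm{Sol}(\mathscr D)$, such that $$R_{\theta_1}(d)=0\iff R_{\theta_2}(T(d))=0\qquad\text{for all } d\in\mathbb R^q .$$ **Theorem.** Suppose that the columns of $\mathcal A$ enumerate, without repetition, the set $\Delta_{q,\ell_1}\cup\cdots\cup\Delta_{q,\ell_M}$, where $\Delta_{q,\ell}=\{\alpha\in\mathbb Z_{\ge0}^q:\alpha_1+\cdots+\alpha_q=\ell\}$ and $\ell_1,\dots,\ell_M$ are nonnegative integers. Then, for every orthogonal transformation $T(d)=Kd$ ($KK^\top=K^\top K=I$) and every data set $\mathscr D$, the OLS problem, the ALS problem with known $\sigma$ (for every $\sigma\ge0$) and the ALS problem with unknown $\sigma$ are all $T$-invariant for $\mathscr D$. -/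

import Mathlib

namespace HypersurfaceFitting

noncomputable section

/-! ### Multidegrees -/

/-- The degree-constrained set: all multidegrees `α ∈ ℤ₊^q` with `|α| = l`. -/
def degSet (q l : ℕ) : Set (Fin q → ℕ) := {α | ∑ i, α i = l}

/-- `A ∼ S`: the columns of the `q × m` matrix `A` enumerate the set `S`, without repetition. -/
def Represents {q m : ℕ} (A : Matrix (Fin q) (Fin m) ℕ) (S : Set (Fin q → ℕ)) : Prop :=
  Function.Injective A.col ∧ Set.range A.col = S

/-- The monomial `d ^ α`, as a polynomial in `q` variables. -/
def monom {q : ℕ} (α : Fin q → ℕ) : MvPolynomial (Fin q) ℝ :=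
  ∏ i, MvPolynomial.X i ^ α i

/-- The vector of monomials given by the columns of `A`. -/
def monomials {q m : ℕ} (A : Matrix (Fin q) (Fin m) ℕ) : Fin m → MvPolynomial (Fin q) ℝ :=
  fun j => monom (A.col j)

/-! ### Values of polynomials, the polynomial `R_θ`, and the Bombieri norm -/

/-- The value of the polynomial `f` at the point `d`. -/
def evalAt {q : ℕ} (f : MvPolynomial (Fin q) ℝ) (d : EuclideanSpace ℝ (Fin q)) : ℝ :=
  MvPolynomial.eval (fun i => d i) f

/-- `R_θ(d) = ∑ j, θ j * φ j (d)`. -/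
def Rpoly {q m : ℕ} (φ : Fin m → MvPolynomial (Fin q) ℝ) (θ : Fin m → ℝ)
    (d : EuclideanSpace ℝ (Fin q)) : ℝ :=
  ∑ j, θ j * evalAt (φ j) d

/-- The Bombieri norm of a coefficient vector with respect to the monomials in the columns of
`A`; its square is `∑ j, (α_1! ⋯ α_q! / (α_1 + ⋯ + α_q)!) * θ j ^ 2` with `α` the `j`-th
column. -/
def bombieriNorm {q m : ℕ} (A : Matrix (Fin q) (Fin m) ℕ) (θ : Fin m → ℝ) : ℝ :=
  Real.sqrt (∑ j, ((∏ i, ((A i j).factorial : ℝ)) / ((∑ i, A i j).factorial : ℝ)) * θ j ^ 2)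

/-! ### Deconvolution -/

/-- `g` is a deconvolution of `f` for the covariance matrix `S`: `E g(a + x) = f(a)` for all
points `a`, where `x ∼ N(0, S)`. -/
def IsDeconvolution {q : ℕ} (S : Matrix (Fin q) (Fin q) ℝ) (f g : MvPolynomial (Fin q) ℝ) :
    Prop :=
  ∀ a : EuclideanSpace ℝ (Fin q),
    ∫ x, evalAt g (a + x) ∂(ProbabilityTheory.multivariateGaussian 0 S) = evalAt f a

theorem evalAt_ext {q : ℕ} {f g : MvPolynomial (Fin q) ℝ} (h : ∀ d, evalAt f d = evalAt g d) :
    f = g := by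
  refine MvPolynomial.funext fun x => ?_
  simpa [evalAt] using h (WithLp.toLp 2 x)

/-- Polynomials are integrable for Gaussian measures, so the expectations above are genuine. -/
theorem integrable_evalAt {q : ℕ} (S : Matrix (Fin q) (Fin q) ℝ) (f : MvPolynomial (Fin q) ℝ) :
    MeasureTheory.Integrable (fun x => evalAt f x)
      (ProbabilityTheory.multivariateGaussian 0 S) := by
  have hcont : ∀ p : MvPolynomial (Fin q) ℝ, Continuous (fun x => evalAt p x) := fun p =>
    (MvPolynomial.continuous_eval p).comp (by fun_prop)
  induction f using MvPolynomial.induction_on' with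
  | monomial s c =>
    have h1 : MeasureTheory.Integrable (fun x : EuclideanSpace ℝ (Fin q) => ‖id x‖ ^ (∑ i, s i))
        (ProbabilityTheory.multivariateGaussian 0 S) :=
      (ProbabilityTheory.IsGaussian.memLp_id _ _ (by simp)).integrable_norm_pow'
    refine (h1.const_mul |c|).mono' (hcont _).aestronglyMeasurable ?_
    refine Filter.Eventually.of_forall fun x => ?_
    simp only [evalAt, MvPolynomial.eval_monomial, Finsupp.prod_pow, norm_mul, norm_prod, norm_pow,
      Real.norm_eq_abs, id]
    refine mul_le_mul_of_nonneg_left ?_ (abs_nonneg c)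
    rw [← Finset.prod_pow_eq_pow_sum]
    refine Finset.prod_le_prod (fun i _ => by positivity) fun i _ => ?_
    exact pow_le_pow_left₀ (abs_nonneg _) (PiLp.norm_apply_le x i) _
  | add p r hp hr =>
    refine (hp.add hr).congr (Filter.Eventually.of_forall fun x => ?_)
    simp [evalAt]

/-- Functions `(a, x) ↦ ∑ r_k(a) p_k(x)` with polynomials `r_k` of degree less than `n`. -/
def lowerSpan (q n : ℕ) :
    Submodule ℝ (EuclideanSpace ℝ (Fin q) → EuclideanSpace ℝ (Fin q) → ℝ) :=
  Submodule.span ℝ {F | ∃ r p : MvPolynomial (Fin q) ℝ, r.totalDegree < n ∧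
    F = fun a x => evalAt r a * evalAt p x}

theorem shift_mem_lowerSpan {q : ℕ} (f : MvPolynomial (Fin q) ℝ) :
    ∀ n, f.totalDegree ≤ n → (fun a x => evalAt f (a + x) - evalAt f a) ∈ lowerSpan q n := by
  have hmono : ∀ s : Fin q →₀ ℕ, ∀ c : ℝ, ∀ n, (MvPolynomial.monomial s c).totalDegree ≤ n →
      (fun a x => evalAt (MvPolynomial.monomial s c) (a + x) -
        evalAt (MvPolynomial.monomial s c) a) ∈ lowerSpan q n := by
    intro s c
    refine MvPolynomial.induction_on_monomial (motive := fun f => ∀ n, f.totalDegree ≤ n →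
      (fun a x => evalAt f (a + x) - evalAt f a) ∈ lowerSpan q n) ?_ ?_ s c
    · intro c n _
      have : (fun a x : EuclideanSpace ℝ (Fin q) => evalAt (MvPolynomial.C c) (a + x) -
          evalAt (MvPolynomial.C c) a) = 0 := by
        funext a x; simp [evalAt]
      rw [this]; exact Submodule.zero_mem _
    · intro f i ih n hn
      by_cases hf : f = 0
      · have : (fun a x : EuclideanSpace ℝ (Fin q) => evalAt (f * MvPolynomial.X i) (a + x) -
            evalAt (f * MvPolynomial.X i) a) = 0 := by
          funext a x; simp [evalAt, hf]
        rw [this]; exact Submodule.zero_mem _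
      rw [MvPolynomial.totalDegree_mul_of_isDomain hf (MvPolynomial.X_ne_zero i),
        MvPolynomial.totalDegree_X] at hn
      have h0 := ih f.totalDegree le_rfl
      set F : EuclideanSpace ℝ (Fin q) → EuclideanSpace ℝ (Fin q) → ℝ :=
        fun a x => evalAt f (a + x) - evalAt f a with hF
      have hmul : ∀ G ∈ lowerSpan q f.totalDegree, (fun a x => (a i + x i) * G a x) ∈
          lowerSpan q n := by
        intro G hG
        induction hG using Submodule.span_induction with
        | mem G hG =>
          obtain ⟨r, p, hr, rfl⟩ := hG
          have e : (fun a x : EuclideanSpace ℝ (Fin q) =>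
              (a i + x i) * (evalAt r a * evalAt p x)) =
              (fun a x => evalAt (MvPolynomial.X i * r) a * evalAt p x) +
              (fun a x => evalAt r a * evalAt (MvPolynomial.X i * p) x) := by
            funext a x; simp [evalAt]; ring
          rw [e]
          refine Submodule.add_mem _ (Submodule.subset_span ⟨_, _, ?_, rfl⟩)
            (Submodule.subset_span ⟨_, _, ?_, rfl⟩)
          · have := MvPolynomial.totalDegree_mul (MvPolynomial.X i) r
            rw [MvPolynomial.totalDegree_X] at this
            omega
          · omega
        | zero =>
          have e : (fun a x : EuclideanSpace ℝ (Fin q) => (a i + x i) *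
              (0 : EuclideanSpace ℝ (Fin q) → EuclideanSpace ℝ (Fin q) → ℝ) a x) = 0 := by
            funext a x; simp
          rw [e]; exact Submodule.zero_mem _
        | add G H _ _ hG hH =>
          have e : (fun a x : EuclideanSpace ℝ (Fin q) => (a i + x i) * (G + H) a x) =
              (fun a x => (a i + x i) * G a x) + (fun a x => (a i + x i) * H a x) := by
            funext a x; simp [mul_add]
          rw [e]; exact Submodule.add_mem _ hG hH
        | smul c G _ hG =>
          have e : (fun a x : EuclideanSpace ℝ (Fin q) => (a i + x i) * (c • G) a x) =
              c • (fun a x => (a i + x i) * G a x) := by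
            funext a x; simp; ring
          rw [e]; exact Submodule.smul_mem _ _ hG
      have e : (fun a x : EuclideanSpace ℝ (Fin q) => evalAt (f * MvPolynomial.X i) (a + x) -
            evalAt (f * MvPolynomial.X i) a) =
          (fun a x => (a i + x i) * F a x) +
          (fun a x => evalAt f a * evalAt (MvPolynomial.X i) x) := by
        funext a x; simp [evalAt, hF]; ring
      rw [e]
      exact Submodule.add_mem _ (hmul F h0) (Submodule.subset_span ⟨_, _, by omega, rfl⟩)
  intro n hn
  have e : (fun a x : EuclideanSpace ℝ (Fin q) => evalAt f (a + x) - evalAt f a) =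
      ∑ s ∈ f.support, fun a x => evalAt (MvPolynomial.monomial s (f.coeff s)) (a + x) -
        evalAt (MvPolynomial.monomial s (f.coeff s)) a := by
    funext a x
    rw [Finset.sum_apply, Finset.sum_apply, Finset.sum_sub_distrib]
    conv_lhs => rw [f.as_sum]
    simp only [evalAt, map_sum]
  rw [e]
  refine Submodule.sum_mem _ fun s hs => hmono s _ n ?_
  exact (MvPolynomial.totalDegree_monomial_le s _).trans ((MvPolynomial.le_totalDegree hs).trans hn)

theorem exists_expectation {q : ℕ} (S : Matrix (Fin q) (Fin q) ℝ) (f : MvPolynomial (Fin q) ℝ) :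
    ∃ r : MvPolynomial (Fin q) ℝ, (r = 0 ∨ r.totalDegree < f.totalDegree) ∧
      ∀ a, ∫ x, evalAt f (a + x) ∂(ProbabilityTheory.multivariateGaussian 0 S) =
        evalAt f a + evalAt r a := by
  have key : ∀ n, ∀ F ∈ lowerSpan q n, ∃ r : MvPolynomial (Fin q) ℝ,
      (r = 0 ∨ r.totalDegree < n) ∧ ∀ a,
        MeasureTheory.Integrable (F a) (ProbabilityTheory.multivariateGaussian 0 S) ∧
        ∫ x, F a x ∂(ProbabilityTheory.multivariateGaussian 0 S) = evalAt r a := by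
    intro n F hF
    induction hF using Submodule.span_induction with
    | mem F hF =>
      obtain ⟨r, p, hr, rfl⟩ := hF
      refine ⟨MvPolynomial.C (∫ x, evalAt p x ∂(ProbabilityTheory.multivariateGaussian 0 S)) * r,
        Or.inr ?_, fun a => ⟨(integrable_evalAt S p).const_mul _, ?_⟩⟩
      · have := MvPolynomial.totalDegree_mul (MvPolynomial.C
          (∫ x, evalAt p x ∂(ProbabilityTheory.multivariateGaussian 0 S))) r
        rw [MvPolynomial.totalDegree_C] at this
        omega
      · rw [MeasureTheory.integral_const_mul]
        simp only [evalAt, map_mul, MvPolynomial.eval_C]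
        ring
    | zero => exact ⟨0, Or.inl rfl, fun a => ⟨by
        simp, by simp [evalAt]⟩⟩
    | add F G _ _ hF hG =>
      obtain ⟨r, hr, hr'⟩ := hF
      obtain ⟨t, ht, ht'⟩ := hG
      refine ⟨r + t, ?_, fun a => ⟨(hr' a).1.add (ht' a).1, ?_⟩⟩
      · have := MvPolynomial.totalDegree_add r t
        rcases hr with rfl | hr
        · simpa using ht
        rcases ht with rfl | ht
        · simpa using Or.inr hr
        exact Or.inr (this.trans_lt (max_lt hr ht))
      · have := MeasureTheory.integral_add (hr' a).1 (ht' a).1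
        simp only [Pi.add_apply]
        rw [this, (hr' a).2, (ht' a).2]
        simp [evalAt]
    | smul c F _ hF =>
      obtain ⟨r, hr, hr'⟩ := hF
      refine ⟨c • r, ?_, fun a => ⟨(hr' a).1.smul c, ?_⟩⟩
      · rcases hr with rfl | hr
        · simp
        exact Or.inr ((MvPolynomial.totalDegree_smul_le c r).trans_lt hr)
      · simp only [Pi.smul_apply]
        rw [MeasureTheory.integral_smul, (hr' a).2]
        simp [evalAt]
  obtain ⟨r, hr, hr'⟩ := key _ _ (shift_mem_lowerSpan f _ le_rfl)
  refine ⟨r, hr, fun a => ?_⟩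
  have h := MeasureTheory.integral_add (hr' a).1
    (MeasureTheory.integrable_const (μ := ProbabilityTheory.multivariateGaussian 0 S) (evalAt f a))
  simp only [sub_add_cancel] at h
  rw [h, (hr' a).2]
  simp [add_comm]

theorem integrable_evalAt_add {q : ℕ} (S : Matrix (Fin q) (Fin q) ℝ)
    (g : MvPolynomial (Fin q) ℝ) (a : EuclideanSpace ℝ (Fin q)) :
    MeasureTheory.Integrable (fun x => evalAt g (a + x))
      (ProbabilityTheory.multivariateGaussian 0 S) := by
  have := integrable_evalAt S (MvPolynomial.bind₁ (fun i => MvPolynomial.C (a i) +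
    MvPolynomial.X i) g)
  refine this.congr (Filter.Eventually.of_forall fun x => ?_)
  simp only [evalAt, MvPolynomial.eval, MvPolynomial.eval₂Hom_bind₁]
  congr 2
  funext i
  simp

theorem exists_isDeconvolution {q : ℕ} (S : Matrix (Fin q) (Fin q) ℝ)
    (f : MvPolynomial (Fin q) ℝ) : ∃ g, IsDeconvolution S f g := by
  have key : ∀ n, ∀ f : MvPolynomial (Fin q) ℝ, f = 0 ∨ f.totalDegree < n →
      ∃ g, IsDeconvolution S f g := by
    intro n
    induction n with
    | zero =>
      rintro f (rfl | h)
      · exact ⟨0, fun a => by simp [evalAt]⟩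
      · omega
    | succ n ih =>
      intro f hf
      obtain ⟨r, hr, hr'⟩ := exists_expectation S f
      obtain ⟨g, hg⟩ := ih r (by
        rcases hr with hr | hr
        · exact Or.inl hr
        rcases hf with rfl | hf
        · simp at hr
        · exact Or.inr (by omega))
      refine ⟨f - g, fun a => ?_⟩
      have := MeasureTheory.integral_sub (integrable_evalAt_add S f a) (integrable_evalAt_add S g a)
      rw [hr' a, hg a] at this
      simpa [evalAt] using this
  exact key (f.totalDegree + 1) f (Or.inr (Nat.lt_succ_self _))

theorem IsDeconvolution.unique {q : ℕ} {S : Matrix (Fin q) (Fin q) ℝ}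
    {f g h : MvPolynomial (Fin q) ℝ} (hg : IsDeconvolution S f g) (hh : IsDeconvolution S f h) :
    g = h := by
  obtain ⟨r, hr, hr'⟩ := exists_expectation S (g - h)
  have h0 : g - h = -r := evalAt_ext fun a => by
    have h1 := hr' a
    have h2 := MeasureTheory.integral_sub (integrable_evalAt_add S g a) (integrable_evalAt_add S h a)
    rw [hg a, hh a, sub_self] at h2
    have h3 : ∫ x, evalAt (g - h) (a + x) ∂(ProbabilityTheory.multivariateGaussian 0 S) = 0 := by
      simpa [evalAt] using h2
    rw [h3] at h1
    have : evalAt (-r) a = - evalAt r a := by simp [evalAt]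
    rw [this]; linarith
  rcases hr with rfl | hr
  · simpa [sub_eq_zero] using h0
  · rw [h0, MvPolynomial.totalDegree_neg] at hr
    omega

/-- The deconvolution `f ∗ p_{-S}`: the unique polynomial `g` with `E g(a + x) = f(a)` for all
`a`, where `x ∼ N(0, S)`. -/
def deconvolution {q : ℕ} (S : Matrix (Fin q) (Fin q) ℝ) (f : MvPolynomial (Fin q) ℝ) :
    MvPolynomial (Fin q) ℝ :=
  Classical.choose (exists_isDeconvolution S f)

theorem isDeconvolution_deconvolution {q : ℕ} (S : Matrix (Fin q) (Fin q) ℝ)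
    (f : MvPolynomial (Fin q) ℝ) : IsDeconvolution S f (deconvolution S f) :=
  Classical.choose_spec (exists_isDeconvolution S f)

/-! ### Cost functions -/

/-- The OLS cost: the sum of the squared residuals. -/
def Qols {q m N : ℕ} (φ : Fin m → MvPolynomial (Fin q) ℝ) (θ : Fin m → ℝ)
    (D : Fin N → EuclideanSpace ℝ (Fin q)) : ℝ :=
  ∑ k, Rpoly φ θ (D k) ^ 2

/-- The adjusted matrix `Ψ(D, σ)` for the noise covariance `σ² S₀`. -/
def adjustedMatrix {q m N : ℕ} (S₀ : Matrix (Fin q) (Fin q) ℝ)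
    (φ : Fin m → MvPolynomial (Fin q) ℝ) (D : Fin N → EuclideanSpace ℝ (Fin q)) (σ : ℝ) :
    Matrix (Fin m) (Fin m) ℝ :=
  Matrix.of fun i j => ∑ k, evalAt (deconvolution (σ ^ 2 • S₀) (φ i * φ j)) (D k)

/-- The ALS cost: `θᵀ Ψ(D, σ) θ`. -/
def Qals {q m N : ℕ} (S₀ : Matrix (Fin q) (Fin q) ℝ) (φ : Fin m → MvPolynomial (Fin q) ℝ)
    (σ : ℝ) (θ : Fin m → ℝ) (D : Fin N → EuclideanSpace ℝ (Fin q)) : ℝ :=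
  dotProduct θ ((adjustedMatrix S₀ φ D σ).mulVec θ)

/-! ### Solution sets of the estimation problems -/

/-- Solutions of the OLS problem: minimizers of the OLS cost subject to `nrm θ = 1`. -/
def olsSol {q m N : ℕ} (φ : Fin m → MvPolynomial (Fin q) ℝ) (nrm : (Fin m → ℝ) → ℝ)
    (D : Fin N → EuclideanSpace ℝ (Fin q)) : Set (Fin m → ℝ) :=
  {θ | nrm θ = 1 ∧ ∀ θ', nrm θ' = 1 → Qols φ θ D ≤ Qols φ θ' D}

/-- Solutions of the ALS problem with known `σ`: minimizers of the ALS cost subject to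
`nrm θ = 1`. -/
def alsKnownSol {q m N : ℕ} (S₀ : Matrix (Fin q) (Fin q) ℝ)
    (φ : Fin m → MvPolynomial (Fin q) ℝ) (nrm : (Fin m → ℝ) → ℝ) (σ : ℝ)
    (D : Fin N → EuclideanSpace ℝ (Fin q)) : Set (Fin m → ℝ) :=
  {θ | nrm θ = 1 ∧ ∀ θ', nrm θ' = 1 → Qals S₀ φ σ θ D ≤ Qals S₀ φ σ θ' D}

/-- Solutions of the ALS problem with unknown `σ`: those `θ` with `nrm θ = 1` for which some
`σ' ≥ 0` satisfies `Q_{als,σ'}(θ, D) = 0` and `Q_{als,σ'}(b, D) ≥ 0` for all `b ≠ 0`. -/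
def alsUnknownSol {q m N : ℕ} (S₀ : Matrix (Fin q) (Fin q) ℝ)
    (φ : Fin m → MvPolynomial (Fin q) ℝ) (nrm : (Fin m → ℝ) → ℝ)
    (D : Fin N → EuclideanSpace ℝ (Fin q)) : Set (Fin m → ℝ) :=
  {θ | ∃ σ' : ℝ, 0 ≤ σ' ∧ Qals S₀ φ σ' θ D = 0 ∧ nrm θ = 1 ∧
    ∀ b : Fin m → ℝ, b ≠ 0 → 0 ≤ Qals S₀ φ σ' b D}

/-! ### Invariance -/

/-- The affine transformation `d ↦ K d + h`. -/
def affineTransformation {q : ℕ} (K : Matrix (Fin q) (Fin q) ℝ) (h : EuclideanSpace ℝ (Fin q)) :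
    EuclideanSpace ℝ (Fin q) → EuclideanSpace ℝ (Fin q) :=
  fun d => WithLp.toLp 2 (K.mulVec (WithLp.ofLp d)) + h

/-- An orthogonal transformation: `d ↦ K d` with `K Kᵀ = Kᵀ K = I`. -/
def IsOrthogonalTransformation {q : ℕ}
    (T : EuclideanSpace ℝ (Fin q) → EuclideanSpace ℝ (Fin q)) : Prop :=
  ∃ K : Matrix (Fin q) (Fin q) ℝ, K * K.transpose = 1 ∧ K.transpose * K = 1 ∧
    T = affineTransformation K 0

/-- For the data `D`, the problem with solution sets `Sol` is `T ⇒` invariant. -/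
def ForwardInvariant {q m N : ℕ} (φ : Fin m → MvPolynomial (Fin q) ℝ)
    (Sol : (Fin N → EuclideanSpace ℝ (Fin q)) → Set (Fin m → ℝ))
    (T : EuclideanSpace ℝ (Fin q) → EuclideanSpace ℝ (Fin q))
    (D : Fin N → EuclideanSpace ℝ (Fin q)) : Prop :=
  ∀ θ₁ ∈ Sol D, ∃ θ₂ ∈ Sol (fun k => T (D k)), ∀ d, Rpoly φ θ₁ d = 0 ↔ Rpoly φ θ₂ (T d) = 0

/-- For the data `D`, the problem with solution sets `Sol` is `T ⇐` invariant. -/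
def BackwardInvariant {q m N : ℕ} (φ : Fin m → MvPolynomial (Fin q) ℝ)
    (Sol : (Fin N → EuclideanSpace ℝ (Fin q)) → Set (Fin m → ℝ))
    (T : EuclideanSpace ℝ (Fin q) → EuclideanSpace ℝ (Fin q))
    (D : Fin N → EuclideanSpace ℝ (Fin q)) : Prop :=
  ∀ θ₂ ∈ Sol (fun k => T (D k)), ∃ θ₁ ∈ Sol D, ∀ d, Rpoly φ θ₁ d = 0 ↔ Rpoly φ θ₂ (T d) = 0

/-- For the data `D`, the problem with solution sets `Sol` is `T`-invariant. -/
def Invariant {q m N : ℕ} (φ : Fin m → MvPolynomial (Fin q) ℝ)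
    (Sol : (Fin N → EuclideanSpace ℝ (Fin q)) → Set (Fin m → ℝ))
    (T : EuclideanSpace ℝ (Fin q) → EuclideanSpace ℝ (Fin q))
    (D : Fin N → EuclideanSpace ℝ (Fin q)) : Prop :=
  ForwardInvariant φ Sol T D ∧ BackwardInvariant φ Sol T D

end

end HypersurfaceFitting

open HypersurfaceFitting

namespace HypersurfaceFitting

open MeasureTheory ProbabilityTheory Matrix

/-! ### Orthogonal substitutions in polynomials -/

/-! Since whole degree classes occur among the monomials, substituting `K d` for `d` maps their span
to itself: the vector `e(d)` of monomials satisfies `e(K d) = B e(d)`, hence `R_θ(K d) = R_{Lθ}(d)`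
with `L = Bᵀ`. Everything reduces to showing that `L` is onto and preserves both the constraint and
the costs; then `L` matches the solutions for `T(D)` with those for `D`, and the zero sets
correspond.

Constraint: the inverse Bombieri weights are multinomial coefficients, so with `W` the diagonal
weight matrix and `V = W⁻¹`, the kernel `e(x)ᵀ V e(y)` is a sum of powers of `⟨x, y⟩` and is
unchanged by `K`. This gives `Bᵀ V B = V` (`transpose_mul_diagonal_mul`); taking inverses, `B W Bᵀ =
W`, which says that `L` is a Bombieri isometry (`exists_bombieri_isometry`).

Costs: OLS only evaluates `R_θ` at the data. The ALS cost sums the deconvolution of `R_θ²` over the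
data (`Qals_eq_sum_deconvolution`), and deconvolution commutes with `K` because `N(0, σ² I)` is
rotation invariant (`deconvolution_linSubst`). -/

/-- The polynomial `d ↦ f (K d)`. -/
noncomputable def linSubst {q : ℕ} (K : Matrix (Fin q) (Fin q) ℝ) (f : MvPolynomial (Fin q) ℝ) :
    MvPolynomial (Fin q) ℝ :=
  MvPolynomial.bind₁ (fun i => ∑ j, MvPolynomial.C (K i j) * MvPolynomial.X j) f

theorem affineTransformation_zero_apply {q : ℕ} (K : Matrix (Fin q) (Fin q) ℝ)
    (d : EuclideanSpace ℝ (Fin q)) (i : Fin q) :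
    affineTransformation K 0 d i = ∑ j, K i j * d j := by
  simp [affineTransformation, Matrix.mulVec, dotProduct]

theorem affineTransformation_zero_add {q : ℕ} (K : Matrix (Fin q) (Fin q) ℝ)
    (a x : EuclideanSpace ℝ (Fin q)) :
    affineTransformation K 0 (a + x) = affineTransformation K 0 a + affineTransformation K 0 x := by
  simp [affineTransformation, Matrix.mulVec_add]

theorem continuous_affineTransformation {q : ℕ} (K : Matrix (Fin q) (Fin q) ℝ)
    (h : EuclideanSpace ℝ (Fin q)) : Continuous (affineTransformation K h) := by
  unfold affineTransformation
  fun_prop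

theorem continuous_evalAt {q : ℕ} (f : MvPolynomial (Fin q) ℝ) : Continuous (evalAt f) :=
  (MvPolynomial.continuous_eval f).comp (by fun_prop)

theorem evalAt_linSubst {q : ℕ} (K : Matrix (Fin q) (Fin q) ℝ) (f : MvPolynomial (Fin q) ℝ)
    (d : EuclideanSpace ℝ (Fin q)) :
    evalAt (linSubst K f) d = evalAt f (affineTransformation K 0 d) := by
  simp only [evalAt, linSubst, MvPolynomial.eval, MvPolynomial.eval₂Hom_bind₁]
  congr 2
  funext i
  simp [affineTransformation_zero_apply]

theorem dotProduct_affineTransformation {q : ℕ} {K : Matrix (Fin q) (Fin q) ℝ}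
    (hK : Kᵀ * K = 1) (x y : EuclideanSpace ℝ (Fin q)) :
    ∑ i, affineTransformation K 0 x i * affineTransformation K 0 y i = ∑ i, x i * y i := by
  have h : (K *ᵥ x.ofLp) ⬝ᵥ (K *ᵥ y.ofLp) = x.ofLp ⬝ᵥ y.ofLp := by
    rw [Matrix.dotProduct_mulVec, Matrix.vecMul_mulVec, hK, Matrix.vecMul_one]
  simpa [affineTransformation, dotProduct] using h

/-! ### Isotropic Gaussian measures and deconvolution -/

/-- Moving `K` across the inner product turns the characteristic function of the image at `t` into
the original one at `Kᵀ t`; for covariance `c I` and mean zero it depends only on the length of `t`,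
which `Kᵀ` preserves. -/
theorem map_multivariateGaussian_smul_one {q : ℕ} {K : Matrix (Fin q) (Fin q) ℝ}
    (hK : K * Kᵀ = 1) {c : ℝ} (hc : 0 ≤ c) :
    (multivariateGaussian 0 (c • (1 : Matrix (Fin q) (Fin q) ℝ))).map
      (affineTransformation K 0) = multivariateGaussian 0 (c • 1) := by
  have hS : (c • (1 : Matrix (Fin q) (Fin q) ℝ)).PosSemidef := Matrix.PosSemidef.one.smul hc
  have hm := (continuous_affineTransformation K 0).measurable
  have := Measure.isProbabilityMeasure_map
    (μ := multivariateGaussian 0 (c • (1 : Matrix (Fin q) (Fin q) ℝ))) hm.aemeasurable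
  refine Measure.ext_of_charFun (funext fun t => ?_)
  have h1 : charFun ((multivariateGaussian 0 (c • (1 : Matrix (Fin q) (Fin q) ℝ))).map
      (affineTransformation K 0)) t =
      charFun (multivariateGaussian 0 (c • (1 : Matrix (Fin q) (Fin q) ℝ)))
        (affineTransformation Kᵀ 0 t) := by
    rw [charFun_apply, charFun_apply, integral_map hm.aemeasurable (by fun_prop)]
    congr 1
    funext x
    congr 3
    simp only [EuclideanSpace.inner_eq_star_dotProduct, affineTransformation, add_zero,
      star_trivial]
    rw [Matrix.dotProduct_mulVec, ← Matrix.mulVec_transpose]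
  have h2 := dotProduct_affineTransformation (K := Kᵀ) (by simpa using hK) t t
  rw [h1, charFun_multivariateGaussian hS, charFun_multivariateGaussian hS]
  simp only [Matrix.smul_mulVec, Matrix.one_mulVec, dotProduct_smul, inner_zero_right]
  simp only [dotProduct, h2]

theorem isDeconvolution_linSubst {q : ℕ} {K : Matrix (Fin q) (Fin q) ℝ}
    (hK : K * Kᵀ = 1) {c : ℝ} (hc : 0 ≤ c) {f g : MvPolynomial (Fin q) ℝ}
    (h : IsDeconvolution (c • 1) f g) :
    IsDeconvolution (c • 1) (linSubst K f) (linSubst K g) := by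
  intro a
  rw [evalAt_linSubst, ← h (affineTransformation K 0 a)]
  -- Only the measure on the right becomes a push-forward; the change of variables then turns its
  -- integrand into `g (K a + K x) = g (K (a + x))`.
  nth_rw 2 [← map_multivariateGaussian_smul_one hK hc]
  have hg : Continuous fun x => evalAt g (affineTransformation K 0 a + x) :=
    (continuous_evalAt g).comp (by fun_prop)
  rw [integral_map (continuous_affineTransformation K 0).aemeasurable hg.aestronglyMeasurable]
  simp only [evalAt_linSubst, affineTransformation_zero_add]

theorem deconvolution_linSubst {q : ℕ} {K : Matrix (Fin q) (Fin q) ℝ}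
    (hK : K * Kᵀ = 1) {c : ℝ} (hc : 0 ≤ c) (f : MvPolynomial (Fin q) ℝ) :
    deconvolution (c • 1) (linSubst K f) = linSubst K (deconvolution (c • 1) f) :=
  (isDeconvolution_deconvolution _ _).unique
    (isDeconvolution_linSubst hK hc (isDeconvolution_deconvolution _ _))

theorem IsDeconvolution.sum {q : ℕ} {ι : Type*} {S : Matrix (Fin q) (Fin q) ℝ} (s : Finset ι)
    (c : ι → ℝ) {f g : ι → MvPolynomial (Fin q) ℝ} (h : ∀ i, IsDeconvolution S (f i) (g i)) :
    IsDeconvolution S (∑ i ∈ s, MvPolynomial.C (c i) * f i)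
      (∑ i ∈ s, MvPolynomial.C (c i) * g i) := by
  intro a
  have e : ∀ (u : ι → MvPolynomial (Fin q) ℝ) (d : EuclideanSpace ℝ (Fin q)),
      evalAt (∑ i ∈ s, MvPolynomial.C (c i) * u i) d = ∑ i ∈ s, c i * evalAt (u i) d := by
    intro u d
    simp [evalAt]
  simp only [e]
  rw [integral_finsetSum _ fun i _ => (integrable_evalAt_add S (g i) a).const_mul (c i)]
  refine Finset.sum_congr rfl fun i _ => ?_
  rw [integral_const_mul, h i a]

/-! ### The ALS cost in terms of the polynomial `R_θ` -/

/-- The polynomial `R_θ`. -/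
noncomputable def paramPoly {q m : ℕ} (φ : Fin m → MvPolynomial (Fin q) ℝ) (θ : Fin m → ℝ) :
    MvPolynomial (Fin q) ℝ :=
  ∑ j, MvPolynomial.C (θ j) * φ j

theorem evalAt_paramPoly {q m : ℕ} (φ : Fin m → MvPolynomial (Fin q) ℝ) (θ : Fin m → ℝ)
    (d : EuclideanSpace ℝ (Fin q)) : evalAt (paramPoly φ θ) d = Rpoly φ θ d := by
  simp [evalAt, paramPoly, Rpoly]

/-- Deconvolution is linear, by uniqueness, so the quadratic form of `Ψ` reassembles the products `φ
i * φ j` into `R_θ²`. The cost thus depends on `θ` only through the polynomial, not on the chosen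
monomial basis. -/
theorem Qals_eq_sum_deconvolution {q m N : ℕ} (S₀ : Matrix (Fin q) (Fin q) ℝ)
    (φ : Fin m → MvPolynomial (Fin q) ℝ) (σ : ℝ) (θ : Fin m → ℝ)
    (D : Fin N → EuclideanSpace ℝ (Fin q)) :
    Qals S₀ φ σ θ D = ∑ k, evalAt (deconvolution (σ ^ 2 • S₀) (paramPoly φ θ ^ 2)) (D k) := by
  have h1 : deconvolution (σ ^ 2 • S₀) (paramPoly φ θ ^ 2) =
      ∑ p : Fin m × Fin m, MvPolynomial.C (θ p.1 * θ p.2) *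
        deconvolution (σ ^ 2 • S₀) (φ p.1 * φ p.2) := by
    refine (isDeconvolution_deconvolution _ _).unique ?_
    have e : paramPoly φ θ ^ 2 =
        ∑ p : Fin m × Fin m, MvPolynomial.C (θ p.1 * θ p.2) * (φ p.1 * φ p.2) := by
      rw [sq, paramPoly, Finset.sum_mul_sum, Fintype.sum_prod_type]
      refine Finset.sum_congr rfl fun i _ => Finset.sum_congr rfl fun j _ => ?_
      rw [MvPolynomial.C_mul]
      ring
    rw [e]
    exact IsDeconvolution.sum _ _ fun p => isDeconvolution_deconvolution _ _
  have h2 : ∀ d, evalAt (deconvolution (σ ^ 2 • S₀) (paramPoly φ θ ^ 2)) d =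
      ∑ i, ∑ j, θ i * θ j * evalAt (deconvolution (σ ^ 2 • S₀) (φ i * φ j)) d := by
    intro d
    rw [h1, ← Fintype.sum_prod_type']
    simp [evalAt]
  simp only [h2, Qals, adjustedMatrix, dotProduct, Matrix.mulVec, Matrix.of_apply,
    Finset.mul_sum, Finset.sum_mul]
  rw [Finset.sum_comm (s := (Finset.univ : Finset (Fin N)))]
  refine Finset.sum_congr rfl fun i _ => ?_
  rw [Finset.sum_comm (s := (Finset.univ : Finset (Fin N)))]
  refine Finset.sum_congr rfl fun j _ => Finset.sum_congr rfl fun k _ => ?_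
  ring

/-! ### Monomials of prescribed degrees -/

theorem monom_eq_monomial {q : ℕ} (α : Fin q → ℕ) :
    monom α = MvPolynomial.monomial (Finsupp.equivFunOnFinite.symm α) 1 := by
  rw [MvPolynomial.monomial_eq, Finsupp.prod_fintype _ _ (by simp)]
  simp [monom]

theorem evalAt_monom {q : ℕ} (α : Fin q → ℕ) (d : EuclideanSpace ℝ (Fin q)) :
    evalAt (monom α) d = ∏ i, d i ^ α i := by
  simp [evalAt, monom]

theorem Rpoly_monomials_eq_zero {q m : ℕ} {A : Matrix (Fin q) (Fin m) ℕ}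
    (hA : Function.Injective A.col) {c : Fin m → ℝ}
    (h : ∀ d, Rpoly (monomials A) c d = 0) : c = 0 := by
  have h0 : paramPoly (monomials A) c = 0 := evalAt_ext fun d => by
    rw [evalAt_paramPoly, h d]
    simp [evalAt]
  funext j
  have h1 := congrArg (MvPolynomial.coeff (Finsupp.equivFunOnFinite.symm (A.col j))) h0
  simpa [paramPoly, monomials, monom_eq_monomial, MvPolynomial.coeff_sum,
    MvPolynomial.coeff_monomial, MvPolynomial.coeff_C_mul, hA.eq_iff] using h1

theorem exists_Rpoly_eq {q m : ℕ} {A : Matrix (Fin q) (Fin m) ℕ}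
    (hA : Function.Injective A.col) (p : MvPolynomial (Fin q) ℝ)
    (hp : ∀ s ∈ p.support, ⇑s ∈ Set.range A.col) :
    ∃ c : Fin m → ℝ, ∀ d, evalAt p d = Rpoly (monomials A) c d := by
  refine ⟨fun j => p.coeff (Finsupp.equivFunOnFinite.symm (A.col j)), fun d => ?_⟩
  rw [← evalAt_paramPoly]
  congr 1
  ext s
  simp only [paramPoly, monomials, monom_eq_monomial, MvPolynomial.coeff_sum,
    MvPolynomial.coeff_C_mul, MvPolynomial.coeff_monomial, mul_ite, mul_one, mul_zero]
  by_cases hs : ⇑s ∈ Set.range A.col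
  · obtain ⟨j, hj⟩ := hs
    have hs : s = Finsupp.equivFunOnFinite.symm (A.col j) := by
      rw [hj]
      exact (Finsupp.equivFunOnFinite_symm_coe s).symm
    subst hs
    simp [hA.eq_iff]
  · rw [Finset.sum_eq_zero, MvPolynomial.notMem_support_iff.1 fun h => hs (hp s h)]
    intro j _
    rw [if_neg]
    rintro rfl
    exact hs ⟨j, by simp⟩

theorem isHomogeneous_linSubst_monom {q : ℕ} (K : Matrix (Fin q) (Fin q) ℝ) (α : Fin q → ℕ) :
    (linSubst K (monom α)).IsHomogeneous (∑ i, α i) := by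
  simp only [linSubst, monom, map_prod, map_pow, MvPolynomial.bind₁_X_right]
  refine MvPolynomial.IsHomogeneous.prod _ _ _ fun i _ => ?_
  have h : (∑ j, MvPolynomial.C (K i j) * MvPolynomial.X j :
      MvPolynomial (Fin q) ℝ).IsHomogeneous 1 :=
    MvPolynomial.IsHomogeneous.sum _ _ _ fun j _ => MvPolynomial.isHomogeneous_C_mul_X _ _
  simpa using h.pow (α i)

/-- The action of a linear substitution on the monomials in the columns of `A`. -/
theorem exists_substitution_matrix {q m M : ℕ} {l : Fin M → ℕ} {A : Matrix (Fin q) (Fin m) ℕ}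
    (hA : Represents A (⋃ i, degSet q (l i))) (K : Matrix (Fin q) (Fin q) ℝ) :
    ∃ B : Matrix (Fin m) (Fin m) ℝ, ∀ j d,
      evalAt (monomials A j) (affineTransformation K 0 d) =
        ∑ i, B j i * evalAt (monomials A i) d := by
  have h : ∀ j, ∃ c : Fin m → ℝ, ∀ d,
      evalAt (linSubst K (monomials A j)) d = Rpoly (monomials A) c d := by
    intro j
    refine exists_Rpoly_eq hA.1 _ fun s hs => ?_
    -- The substituted monomial is homogeneous of its original degree; as all multidegrees of that
    -- degree are columns of `A`, no term leaves the span.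
    have h1 : s.degree = ∑ i, A.col j i := by
      by_contra hne
      exact MvPolynomial.mem_support_iff.1 hs
        ((isHomogeneous_linSubst_monom K (A.col j)).coeff_eq_zero hne)
    have h2 : A.col j ∈ ⋃ i, degSet q (l i) := hA.2 ▸ Set.mem_range_self j
    rw [hA.2]
    simp only [Set.mem_iUnion, degSet, Set.mem_ofPred_eq] at h2 ⊢
    rwa [← Finsupp.degree_eq_sum, h1]
  choose B hB using h
  exact ⟨B, fun j d => by rw [← evalAt_linSubst, hB]; rfl⟩

/-! ### The Bombieri norm and its reproducing kernel -/

/-- The weights of the Bombieri norm. -/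
noncomputable def bombieriWeight {q : ℕ} (α : Fin q → ℕ) : ℝ :=
  (∏ i, ((α i).factorial : ℝ)) / ((∑ i, α i).factorial : ℝ)

theorem bombieriWeight_pos {q : ℕ} (α : Fin q → ℕ) : 0 < bombieriWeight α := by
  unfold bombieriWeight
  positivity

theorem multinomial_eq_inv_bombieriWeight {q : ℕ} (α : Fin q → ℕ) :
    (Nat.multinomial Finset.univ α : ℝ) = (bombieriWeight α)⁻¹ := by
  rw [bombieriWeight, inv_div, Nat.multinomial,
    Nat.cast_div (Nat.prod_factorial_dvd_factorial_sum _ _) (by positivity), Nat.cast_prod]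

/-- The reproducing kernel of the Bombieri inner product. -/
theorem sum_inv_bombieriWeight_mul {q m M : ℕ} {l : Fin M → ℕ} {A : Matrix (Fin q) (Fin m) ℕ}
    (hA : Represents A (⋃ i, degSet q (l i))) (x y : EuclideanSpace ℝ (Fin q)) :
    ∑ j, (bombieriWeight (A.col j))⁻¹ * (evalAt (monomials A j) x * evalAt (monomials A j) y) =
      ∑ n ∈ Finset.univ.image l, (∑ i, x i * y i) ^ n := by
  -- Multinomial theorem for each power. The sum runs over the image of `l` because degrees may
  -- repeat in `l` while columns of `A` do not; distinct degrees give disjoint sets of multidegrees.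
  simp only [Finset.sum_pow_eq_sum_piAntidiag]
  rw [← Finset.sum_biUnion]
  · refine Finset.sum_nbij A.col ?_ hA.1.injOn ?_ ?_
    · intro j _
      have h : A.col j ∈ ⋃ i, degSet q (l i) := hA.2 ▸ Set.mem_range_self j
      obtain ⟨i, hi⟩ := Set.mem_iUnion.1 h
      exact Finset.mem_biUnion.2 ⟨l i, by simp,
        Finset.mem_piAntidiag.2 ⟨hi, fun _ _ => Finset.mem_univ _⟩⟩
    · intro α hα
      have h : α ∈ Set.range A.col := by
        rw [hA.2]
        simpa [degSet, eq_comm] using hα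
      simpa using h
    · intro j _
      simp only [monomials, evalAt_monom, multinomial_eq_inv_bombieriWeight, mul_pow,
        Finset.prod_mul_distrib]
  · intro a _ b _ hab
    refine Finset.disjoint_left.2 fun α ha hb => hab ?_
    rw [← (Finset.mem_piAntidiag.1 ha).1, ← (Finset.mem_piAntidiag.1 hb).1]

theorem bombieriNorm_eq {q m : ℕ} (A : Matrix (Fin q) (Fin m) ℕ) (θ : Fin m → ℝ) :
    bombieriNorm A θ =
      Real.sqrt (θ ⬝ᵥ (Matrix.diagonal (fun j => bombieriWeight (A.col j)) *ᵥ θ)) := by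
  rw [bombieriNorm]
  congr 1
  simp only [dotProduct, Matrix.mulVec_diagonal]
  refine Finset.sum_congr rfl fun j _ => ?_
  simp only [bombieriWeight, Matrix.col_apply]
  ring

/-- Both sides define the same bilinear form on pairs `e x`, `e y`, because the kernel depends only
on `⟨x, y⟩`. No nonzero vector is orthogonal to all `e d`, by independence of the monomials, so the
matrices agree. -/
theorem transpose_mul_diagonal_mul {q m M : ℕ} {l : Fin M → ℕ} {A : Matrix (Fin q) (Fin m) ℕ}
    (hA : Represents A (⋃ i, degSet q (l i))) {K : Matrix (Fin q) (Fin q) ℝ} (hK : Kᵀ * K = 1)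
    {B : Matrix (Fin m) (Fin m) ℝ}
    (hB : ∀ j d, evalAt (monomials A j) (affineTransformation K 0 d) =
        ∑ i, B j i * evalAt (monomials A i) d) :
    Bᵀ * Matrix.diagonal (fun j => (bombieriWeight (A.col j))⁻¹) * B =
      Matrix.diagonal (fun j => (bombieriWeight (A.col j))⁻¹) := by
  set V := Matrix.diagonal (fun j => (bombieriWeight (A.col j))⁻¹) with hV
  let e : EuclideanSpace ℝ (Fin q) → Fin m → ℝ := fun d j => evalAt (monomials A j) d
  have hker : ∀ x y, e x ⬝ᵥ (V *ᵥ e y) = ∑ n ∈ Finset.univ.image l, (∑ i, x i * y i) ^ n := by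
    intro x y
    rw [← sum_inv_bombieriWeight_mul hA]
    simp only [dotProduct, hV, Matrix.mulVec_diagonal, e]
    exact Finset.sum_congr rfl fun j _ => by ring
  have he : ∀ d, e (affineTransformation K 0 d) = B *ᵥ e d := fun d => funext fun j => hB j d
  have hinv : ∀ x y, e x ⬝ᵥ ((Bᵀ * V * B - V) *ᵥ e y) = 0 := by
    intro x y
    have h := hker (affineTransformation K 0 x) (affineTransformation K 0 y)
    rw [dotProduct_affineTransformation hK, ← hker, he, he] at h
    rw [Matrix.sub_mulVec, dotProduct_sub, sub_eq_zero, ← h, ← Matrix.mulVec_mulVec,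
      ← Matrix.mulVec_mulVec, Matrix.dotProduct_mulVec, Matrix.vecMul_transpose]
  have hzero : ∀ c : Fin m → ℝ, (∀ d, e d ⬝ᵥ c = 0) → c = 0 := fun c hc =>
    Rpoly_monomials_eq_zero hA.1 fun d => by rw [← hc d, dotProduct_comm]; rfl
  have h1 : ∀ y, (Bᵀ * V * B - V) *ᵥ e y = 0 := fun y => hzero _ fun x => hinv x y
  rw [← sub_eq_zero]
  ext i
  refine congrFun (hzero _ fun d => ?_) _
  rw [dotProduct_comm]
  exact congrFun (h1 d) i

/-- Orthogonal transformations act on the coefficient vectors by isometries of the Bombieri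
norm. -/
theorem exists_bombieri_isometry {q m M : ℕ} {l : Fin M → ℕ} {A : Matrix (Fin q) (Fin m) ℕ}
    (hA : Represents A (⋃ i, degSet q (l i))) {K : Matrix (Fin q) (Fin q) ℝ} (hK : Kᵀ * K = 1) :
    ∃ L : (Fin m → ℝ) → (Fin m → ℝ), Function.Surjective L ∧ L 0 = 0 ∧
      (∀ θ, bombieriNorm A (L θ) = bombieriNorm A θ) ∧
      ∀ θ d, Rpoly (monomials A) (L θ) d = Rpoly (monomials A) θ (affineTransformation K 0 d) := by
  obtain ⟨B, hB⟩ := exists_substitution_matrix hA K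
  have h := transpose_mul_diagonal_mul hA hK hB
  set V := Matrix.diagonal (fun j => (bombieriWeight (A.col j))⁻¹)
  set W := Matrix.diagonal (fun j => bombieriWeight (A.col j)) with hW
  have hVW : V * W = 1 := by
    simp [V, W, Matrix.diagonal_mul_diagonal, (bombieriWeight_pos _).ne']
  have hWV : W * V = 1 := mul_eq_one_comm.1 hVW
  -- This right inverse of `Bᵀ` yields surjectivity of `L`. For square matrices it is also a left
  -- inverse, which converts invariance of `V` into invariance of `W`.
  have h1 : Bᵀ * (V * B * W) = 1 := by
    rw [← Matrix.mul_assoc, ← Matrix.mul_assoc, h, hVW]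
  have h2 : V * B * W * Bᵀ = 1 := mul_eq_one_comm.1 h1
  have h3 : B * W * Bᵀ = W := by
    calc B * W * Bᵀ = W * V * (B * W * Bᵀ) := by rw [hWV, Matrix.one_mul]
      _ = W * (V * B * W * Bᵀ) := by simp only [Matrix.mul_assoc]
      _ = W := by rw [h2, Matrix.mul_one]
  refine ⟨fun θ => Bᵀ *ᵥ θ, fun θ => ⟨(V * B * W) *ᵥ θ, ?_⟩, Matrix.mulVec_zero _, fun θ => ?_,
    fun θ d => ?_⟩
  · simp only [Matrix.mulVec_mulVec, h1, Matrix.one_mulVec]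
  · rw [bombieriNorm_eq, bombieriNorm_eq, ← hW]
    congr 1
    nth_rw 2 [← h3]
    rw [← Matrix.mulVec_mulVec, ← Matrix.mulVec_mulVec, Matrix.dotProduct_mulVec θ B,
      ← Matrix.mulVec_transpose]
  · have e1 : ∀ c d, Rpoly (monomials A) c d = c ⬝ᵥ fun j => evalAt (monomials A j) d :=
      fun _ _ => rfl
    have e2 : (fun j => evalAt (monomials A j) (affineTransformation K 0 d)) =
      B *ᵥ fun j => evalAt (monomials A j) d := funext fun j => hB j d
    rw [e1, e1, e2, Matrix.dotProduct_mulVec, ← Matrix.mulVec_transpose]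

theorem Qals_one_affineTransformation {q m N : ℕ} {K : Matrix (Fin q) (Fin q) ℝ}
    (hK : K * Kᵀ = 1) {φ : Fin m → MvPolynomial (Fin q) ℝ} {θ₁ θ₂ : Fin m → ℝ}
    (h : ∀ d, Rpoly φ θ₁ d = Rpoly φ θ₂ (affineTransformation K 0 d)) (σ : ℝ)
    (D : Fin N → EuclideanSpace ℝ (Fin q)) :
    Qals 1 φ σ θ₁ D = Qals 1 φ σ θ₂ (fun k => affineTransformation K 0 (D k)) := by
  have e : paramPoly φ θ₁ ^ 2 = linSubst K (paramPoly φ θ₂ ^ 2) := by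
    have e1 : paramPoly φ θ₁ = linSubst K (paramPoly φ θ₂) := evalAt_ext fun d => by
      rw [evalAt_linSubst, evalAt_paramPoly, evalAt_paramPoly, h]
    rw [e1, linSubst, linSubst, map_pow]
  rw [Qals_eq_sum_deconvolution, Qals_eq_sum_deconvolution, e,
    deconvolution_linSubst hK (sq_nonneg σ)]
  simp only [evalAt_linSubst]

/-! ### Transport of solution sets -/

/-- Backward invariance takes `θ₁ = L θ₂`; forward invariance needs a preimage of `θ₁`, which is why
surjectivity suffices. -/
theorem Invariant.of_mem_iff {q m N : ℕ} {φ : Fin m → MvPolynomial (Fin q) ℝ}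
    {Sol : (Fin N → EuclideanSpace ℝ (Fin q)) → Set (Fin m → ℝ)}
    {T : EuclideanSpace ℝ (Fin q) → EuclideanSpace ℝ (Fin q)}
    {D : Fin N → EuclideanSpace ℝ (Fin q)} {L : (Fin m → ℝ) → (Fin m → ℝ)}
    (hL : Function.Surjective L) (hR : ∀ θ d, Rpoly φ (L θ) d = Rpoly φ θ (T d))
    (h : ∀ θ, L θ ∈ Sol D ↔ θ ∈ Sol (fun k => T (D k))) : Invariant φ Sol T D := by
  refine ⟨fun θ₁ h₁ => ?_, fun θ₂ h₂ => ⟨L θ₂, (h θ₂).2 h₂, fun d => by rw [hR]⟩⟩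
  obtain ⟨θ₂, rfl⟩ := hL θ₁
  exact ⟨θ₂, (h θ₂).1 h₁, fun d => by rw [hR]⟩

end HypersurfaceFitting

/-! ### Invariance of the three estimation problems -/

open HypersurfaceFitting
theorem mainTheorem3 (q m M : ℕ) (l : Fin M → ℕ) (A : Matrix (Fin q) (Fin m) ℕ)
    (hA : Represents A (⋃ i, degSet q (l i)))
    (T : EuclideanSpace ℝ (Fin q) → EuclideanSpace ℝ (Fin q))
    (hT : IsOrthogonalTransformation T)
    (N : ℕ) (D : Fin N → EuclideanSpace ℝ (Fin q)) :
    Invariant (monomials A) (olsSol (monomials A) (bombieriNorm A)) T D ∧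
    (∀ σ : ℝ, 0 ≤ σ →
      Invariant (monomials A) (alsKnownSol 1 (monomials A) (bombieriNorm A) σ) T D) ∧
    Invariant (monomials A) (alsUnknownSol 1 (monomials A) (bombieriNorm A)) T D := by
  obtain ⟨K, hK, hK', rfl⟩ := hT
  obtain ⟨L, hL, hL0, hnorm, hR⟩ := exists_bombieri_isometry hA hK'
  have hals : ∀ σ θ, Qals 1 (monomials A) σ (L θ) D =
      Qals 1 (monomials A) σ θ (fun k => affineTransformation K 0 (D k)) := fun σ θ =>
    Qals_one_affineTransformation hK (hR θ) σ D
  refine ⟨.of_mem_iff hL hR fun θ => ?_, fun σ _ => .of_mem_iff hL hR fun θ => ?_,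
    .of_mem_iff hL hR fun θ => ?_⟩
  · have hols : ∀ θ, Qols (monomials A) (L θ) D =
        Qols (monomials A) θ (fun k => affineTransformation K 0 (D k)) := fun θ => by
      simp only [Qols, hR]
    -- Surjectivity lets every competitor for `D` be written as `L θ'`, so both minimality
    -- conditions range over the same `θ'`.
    rw [olsSol, olsSol, Set.mem_ofPred_eq, Set.mem_ofPred_eq, hL.forall]
    simp only [hnorm, hols]
  · rw [alsKnownSol, alsKnownSol, Set.mem_ofPred_eq, Set.mem_ofPred_eq, hL.forall]
    simp only [hnorm, hals]
  -- The form vanishes at `0`, so the restriction `b ≠ 0` can be dropped and `b` reindexed through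
  -- `L` without tracking which vectors `L` sends to zero.
  · have hpos : ∀ σ (D' : Fin N → EuclideanSpace ℝ (Fin q)),
        (∀ b : Fin m → ℝ, b ≠ 0 → 0 ≤ Qals 1 (monomials A) σ b D') ↔
          ∀ b, 0 ≤ Qals 1 (monomials A) σ b D' := fun σ D' =>
      ⟨fun h b => by
        by_cases hb : b = 0
        · simp [hb, Qals]
        · exact h b hb, fun h b _ => h b⟩
    simp only [alsUnknownSol, Set.mem_ofPred_eq, hpos]
    refine exists_congr fun σ => ?_
    rw [hL.forall (p := fun b => 0 ≤ Qals 1 (monomials A) σ b D)]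
    simp only [hnorm, hals]
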